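/- Let $A:\mathbb{R}^d\to\mathbb{R}^d$ be an expansive dilation, that is, a linear map with $A(\mathbb{Z}^d)\subseteq\mathbb{Z}^d$ all of whose complex eigenvalues have modulus strictly greater than $1$; let $A^*$ be its adjoint and $d_A=|\det A|$. Let $G\subseteq\mathbb{R}^d$ be a measurable set with $A^*G=G$ and put $$H^2_G=\{f\in L^2(\mathbb{R}^d):\ \widehat f(\xi)=0\ \text{for a.e. }\xi\notin G\},$$ where $\widehat f$ is the Fourier transform on $L^2(\mathbb{R}^d)$, given by $\widehat f(\xi)=\int_{\mathbb{R}^d}f(x)e^{-2\pi i x\cdot\xi}\,dx$ for $f\in L^1\cap L^2$. Let $\Psi=\{\psi^1,\dots,\psi^N\}\subset L^2(\mathbb{R}^d)$ be an orthogonal multiwavelet of $H^2_G$: the affine system $$\psi^\alpha_{(j,k)}(x)=d_A^{j/2}\,\psi^\alpha(A^jx-k),\qquad j\in\mathbb{Z},\ k\in\mathbb{Z}^d,\ 1\le\alpha\le N,$$ indexed by $(\alpha,j,k)$, is an orthonormal basis of $H^2_G$. Then for every $1\le\alpha\le N$ the origin is a point of $A^*$-approximate continuity of $\widehat{\psi^\alpha}$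 if we put $\widehat{\psi^\alpha}(0)=0$. That is, for every function $g:\mathbb{R}^d\to\mathbb{C}$ which equals $\widehat{\psi^\alpha}$ almost everywhere and has $g(0)=0$, there is a measurable set $E\subseteq\mathbb{R}^d$ of positive measure such that for all $r>0$ $$\lim_{j\to\infty}\frac{|E\cap A^{*-j}B_r|}{|A^{*-j}B_r|}=1$$ and $$\lim_{x\to0,\ x\in E}g(x)=g(0)=0,$$ where $B_r$ is the open ball of radius $r$ about the origin and $|\cdot|$ is Lebesgue measure. -/

import Mathlib

open MeasureTheory Filter Topology
open scoped FourierTransform ENNReal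

noncomputable section

namespace Multiwavelet

/-- The Euclidean space `ℝ^d`. -/
abbrev RSpace (d : ℕ) : Type := EuclideanSpace ℝ (Fin d)

/-- The complex Hilbert space `L²(ℝ^d)`. -/
abbrev L2 (d : ℕ) : Type := Lp ℂ 2 (volume : Measure (RSpace d))

/-- The point of the lattice `ℤ^d ⊆ ℝ^d` with integer coordinates `k`. -/
def latticePoint {d : ℕ} (k : Fin d → ℤ) : RSpace d := WithLp.toLp 2 fun i => (k i : ℝ)

/-- Expansive dilations: linear maps with `A(ℤ^d) ⊆ ℤ^d`, all of whose complex eigenvalues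
(the eigenvalues of the complexification) have modulus strictly greater than `1`. -/
structure IsExpansiveDilation {d : ℕ} (A : RSpace d →ₗ[ℝ] RSpace d) : Prop where
  map_lattice : ∀ k : Fin d → ℤ, ∃ m : Fin d → ℤ, A (latticePoint k) = latticePoint m
  one_lt_norm : ∀ z : ℂ, Module.End.HasEigenvalue (A.baseChange ℂ) z → 1 < ‖z‖

/-- An expansive dilation is injective, as `0` is not an eigenvalue. -/
theorem IsExpansiveDilation.injective {d : ℕ} {A : RSpace d →ₗ[ℝ] RSpace d}
    (hA : IsExpansiveDilation A) : Function.Injective A := by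
  rw [injective_iff_map_eq_zero]
  intro x hx
  by_contra hne
  have hinj : Function.Injective (fun y : RSpace d => (1 : ℂ) ⊗ₜ[ℝ] y) := by
    have := Module.Flat.rTensor_preserves_injective_linearMap (M := RSpace d)
      (Algebra.linearMap ℝ ℂ) (algebraMap ℝ ℂ).injective
    intro y z hyz
    have h2 := @this ((1 : ℝ) ⊗ₜ[ℝ] y) ((1 : ℝ) ⊗ₜ[ℝ] z) (by simpa using hyz)
    simpa using congrArg (TensorProduct.lid ℝ (RSpace d)) h2
  have hev : Module.End.HasEigenvalue (A.baseChange ℂ) 0 := by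
    refine Module.End.hasEigenvalue_of_hasEigenvector (x := (1 : ℂ) ⊗ₜ[ℝ] x) ⟨?_, ?_⟩
    · rw [Module.End.mem_eigenspace_iff]
      simp [hx]
    · intro h0
      exact hne (hinj (by simpa using h0))
  have := hA.one_lt_norm 0 hev
  simp at this
  linarith

/-- An expansive dilation as an element of the group of linear automorphisms of `ℝ^d`, so that
its integer powers `A^j`, `j ∈ ℤ`, make sense. -/
def IsExpansiveDilation.equiv {d : ℕ} {A : RSpace d →ₗ[ℝ] RSpace d}
    (hA : IsExpansiveDilation A) : RSpace d ≃ₗ[ℝ] RSpace d :=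
  LinearEquiv.ofInjectiveEndo A hA.injective

@[simp]
theorem IsExpansiveDilation.equiv_apply {d : ℕ} {A : RSpace d →ₗ[ℝ] RSpace d}
    (hA : IsExpansiveDilation A) (x : RSpace d) : hA.equiv x = A x := rfl

/-- Square integrability is preserved by invertible affine changes of variables. -/
theorem memLp_affine {d : ℕ} (f : L2 d) (T : RSpace d ≃ₗ[ℝ] RSpace d) (v : RSpace d) (c : ℂ) :
    MemLp (fun x => c * f (T x - v)) 2 (volume : Measure (RSpace d)) := by
  have h1 : MemLp (fun x => f (x - v)) 2 (volume : Measure (RSpace d)) :=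
    (Lp.memLp f).comp_measurePreserving (measurePreserving_sub_right volume v)
  have hmap := Measure.map_linearMap_addHaar_eq_smul_addHaar
    (volume : Measure (RSpace d)) (f := (T : RSpace d →ₗ[ℝ] RSpace d))
    (LinearEquiv.isUnit_det' T).ne_zero
  have hcont : Continuous T := LinearMap.continuous_of_finiteDimensional (T : RSpace d →ₗ[ℝ] RSpace d)
  have h2 : MemLp (fun x => f (x - v)) 2
      (Measure.map (T : RSpace d →ₗ[ℝ] RSpace d) (volume : Measure (RSpace d))) := by
    rw [hmap]
    exact h1.smul_measure ENNReal.ofReal_ne_top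
  have h3 := h2.comp_of_map hcont.measurable.aemeasurable
  exact h3.const_mul c

/-- The function `ψ_{(j,k)}(x) = d_A^{j/2} ψ(A^j x - k)` of `L²(ℝ^d)`, where `d_A = |det A|`. -/
def affineElement {d : ℕ} {A : RSpace d →ₗ[ℝ] RSpace d} (hA : IsExpansiveDilation A)
    (ψ : L2 d) (j : ℤ) (k : Fin d → ℤ) : L2 d :=
  (memLp_affine ψ (hA.equiv ^ j) (latticePoint k)
    ((|LinearMap.det A| ^ ((j : ℝ) / 2) : ℝ) : ℂ)).toLp

/-- The affine system `X(Ψ)`, as a family indexed by `(α, j, k)`. -/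
def affineSystem {d : ℕ} {A : RSpace d →ₗ[ℝ] RSpace d} (hA : IsExpansiveDilation A)
    {N : ℕ} (Ψ : Fin N → L2 d) : Fin N × ℤ × (Fin d → ℤ) → L2 d :=
  fun i => affineElement hA (Ψ i.1) i.2.1 i.2.2

/-- The space `H²_G` of all `f ∈ L²(ℝ^d)` whose Fourier transform (the unitary one on `L²`, given by
`∫ f(x) e^{-2πi x·ξ} dx` on `L¹ ∩ L²`) vanishes almost everywhere outside `G`. -/
def H2 {d : ℕ} (G : Set (RSpace d)) : Submodule ℂ (L2 d) where
  carrier := {f | ∀ᵐ ξ ∂(volume : Measure (RSpace d)), ξ ∉ G → (𝓕 f : L2 d) ξ = 0}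
  zero_mem' := by
    have h0 : (𝓕 (0 : L2 d) : L2 d) = 0 := (Lp.fourierTransformₗᵢ (RSpace d) ℂ).map_zero
    simp only [Set.mem_ofPred_eq, h0]
    filter_upwards [Lp.coeFn_zero ℂ 2 (volume : Measure (RSpace d))] with ξ hξ _
    simp [hξ]
  add_mem' := by
    intro f g hf hg
    have h0 : (𝓕 (f + g) : L2 d) = 𝓕 f + 𝓕 g :=
      (Lp.fourierTransformₗᵢ (RSpace d) ℂ).map_add f g
    simp only [Set.mem_ofPred_eq, h0]
    filter_upwards [hf, hg, Lp.coeFn_add (𝓕 f : L2 d) (𝓕 g)] with ξ h1 h2 h3 hξ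
    rw [h3, Pi.add_apply, h1 hξ, h2 hξ, add_zero]
  smul_mem' := by
    intro c f hf
    have h0 : (𝓕 (c • f) : L2 d) = c • 𝓕 f :=
      (Lp.fourierTransformₗᵢ (RSpace d) ℂ).map_smul c f
    simp only [Set.mem_ofPred_eq, h0]
    filter_upwards [hf, Lp.coeFn_smul c (𝓕 f : L2 d)] with ξ h1 h3 hξ
    rw [h3, Pi.smul_apply, h1 hξ, smul_zero]

/-- `Ψ` is an orthogonal multiwavelet of `H²_G`: the affine system `X(Ψ)` is an orthonormal basis
of `H²_G`, i.e. an orthonormal family whose closed linear span is `H²_G`. -/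
def IsOrthogonalMultiwavelet {d : ℕ} {A : RSpace d →ₗ[ℝ] RSpace d} (hA : IsExpansiveDilation A)
    (G : Set (RSpace d)) {N : ℕ} (Ψ : Fin N → L2 d) : Prop :=
  Orthonormal ℂ (affineSystem hA Ψ) ∧
    (Submodule.span ℂ (Set.range (affineSystem hA Ψ))).topologicalClosure = H2 G

/-- The origin is a point of `T`-density for `E`. For invertible `T` the set `T^{-j} B_r` is the
preimage of the ball `B_r` under `T^j`. -/
def IsDensityPoint {d : ℕ} (T : RSpace d →ₗ[ℝ] RSpace d) (E : Set (RSpace d)) : Prop :=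
  ∀ r : ℝ, 0 < r →
    Tendsto (fun j : ℕ =>
        volume (E ∩ (T ^ j) ⁻¹' Metric.ball 0 r) / volume ((T ^ j) ⁻¹' Metric.ball 0 r))
      atTop (𝓝 (1 : ℝ≥0∞))

/-- The origin is a point of `T`-approximate continuity of `f`. -/
def IsApproxContinuousAtOrigin {d : ℕ} (T : RSpace d →ₗ[ℝ] RSpace d) (f : RSpace d → ℂ) : Prop :=
  ∃ E : Set (RSpace d), MeasurableSet E ∧ 0 < volume E ∧ IsDensityPoint T E ∧
    Tendsto f (𝓝[E] 0) (𝓝 (f 0))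

end Multiwavelet

end

/-! Only Bessel's inequality for the orthonormal system is needed. Write $T=A^*$, $q=|\det A|$,
$p=1/q$, and test the system against the function whose Fourier transform is a bump $b$ equal to $1$
on $B_1$ and supported in $\overline{B_2}$. For large $j$ the set $T^{-j}B_2$ lies in the unit cube,
so for fixed $j$ the coefficients against $\psi_{(j,k)}$ are $q^{j/2}$ times Fourier coefficients on
the torus, and Parseval gives $\sum_k|\cdot|^2=q^j\int|b(T^j\eta)\widehat\psi(\eta)|^2d\eta$
(`norm_sq_inner_affineElement`, `hasSum_sq_norm_integral_cube`). Summing over $j$, the averages of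
$|\widehat\psi|^2$ over $T^{-j}B_1$ are summable.

Chebyshev's inequality with slowly decreasing thresholds then discards a part of each $T^{-j}B_1$.
As $|T^{-j}B_1|=p^j|B_1|$ with $p<1$, the discarded parts add up geometrically and have vanishing
density at the origin (`exists_small_set_forall_lt`); off them $\widehat\psi\to0$. -/

namespace Multiwavelet

/-! ### Decay of the powers of the inverse dilation. -/

section Contraction

-- Makes complex matrices a Banach algebra, so that Gelfand's formula applies.
attribute [local instance] Matrix.linftyOpNormedRing Matrix.linftyOpNormedAlgebra

/-- In a complex Banach algebra the powers of an element of spectral radius less than `1` tend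
to `0`. -/
theorem tendsto_pow_zero_of_spectralRadius_lt_one {R : Type*} [NormedRing R] [NormedAlgebra ℂ R]
    [CompleteSpace R] {a : R} (h : spectralRadius ℂ a < 1) :
    Tendsto (fun n : ℕ => a ^ n) atTop (𝓝 0) := by
  obtain ⟨r, hr, hr1⟩ := exists_between h
  have hlt := (spectrum.pow_nnnorm_pow_one_div_tendsto_nhds_spectralRadius a).eventually_lt_const hr
  have h0 : Tendsto (fun n : ℕ => ((‖a ^ n‖₊ : NNReal) : ℝ≥0∞)) atTop (𝓝 0) := by
    refine tendsto_of_tendsto_of_tendsto_of_le_of_le' tendsto_const_nhds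
      (ENNReal.tendsto_pow_atTop_nhds_zero_of_lt_one hr1) (Eventually.of_forall fun _ => zero_le)
      ?_
    -- The exponent $1/n$ is the default value $0$ at $n=0$, which is excluded.
    filter_upwards [hlt, eventually_gt_atTop 0] with n hn hn0
    have hn1 : (0 : ℝ) < n := by exact_mod_cast hn0
    calc ((‖a ^ n‖₊ : NNReal) : ℝ≥0∞)
        = (((‖a ^ n‖₊ : NNReal) : ℝ≥0∞) ^ (1 / (n : ℝ))) ^ (n : ℝ) := by
          rw [← ENNReal.rpow_mul, one_div_mul_cancel hn1.ne', ENNReal.rpow_one]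
      _ ≤ r ^ (n : ℝ) := ENNReal.rpow_le_rpow hn.le hn1.le
      _ = r ^ n := ENNReal.rpow_natCast _ _
  rw [tendsto_zero_iff_norm_tendsto_zero]
  have h1 : Tendsto (fun n : ℕ => ‖a ^ n‖₊) atTop (𝓝 0) := by
    rw [← ENNReal.tendsto_coe]; simpa using h0
  simpa using NNReal.tendsto_coe.2 h1

/-- The complex matrix of the complexification of a real linear endomorphism. -/
noncomputable def complexMatrixHom (d : ℕ) :
    Module.End ℝ (RSpace d) →ₐ[ℝ] Matrix (Fin d) (Fin d) ℂ :=
  ((LinearMap.toMatrixAlgEquiv (Algebra.TensorProduct.basis ℂ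
      (EuclideanSpace.basisFun (Fin d) ℝ).toBasis)).toAlgHom.restrictScalars ℝ).comp
    (Module.End.baseChangeHom ℝ ℂ (RSpace d))

theorem complexMatrixHom_apply {d : ℕ} (f : Module.End ℝ (RSpace d)) :
    complexMatrixHom d f = (LinearMap.toMatrixAlgEquiv (Algebra.TensorProduct.basis ℂ
      (EuclideanSpace.basisFun (Fin d) ℝ).toBasis)) (f.baseChange ℂ) := rfl

/-- Injectivity provides a linear left inverse, automatically continuous in finite dimension, which
carries convergence of complex matrices back to real operators. -/
theorem complexMatrixHom_injective (d : ℕ) : Function.Injective (complexMatrixHom d) := by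
  intro f g h
  apply (LinearMap.toMatrix (EuclideanSpace.basisFun (Fin d) ℝ).toBasis
    (EuclideanSpace.basisFun (Fin d) ℝ).toBasis).injective
  have hf : ∀ f : Module.End ℝ (RSpace d), complexMatrixHom d f =
      (LinearMap.toMatrix (EuclideanSpace.basisFun (Fin d) ℝ).toBasis
        (EuclideanSpace.basisFun (Fin d) ℝ).toBasis f).map (algebraMap ℝ ℂ) := fun f =>
    LinearMap.toMatrix_baseChange ℂ f _ _
  rw [hf, hf] at h
  exact Matrix.map_injective (algebraMap ℝ ℂ).injective h

theorem spectrum_complexMatrixHom {d : ℕ} (f : Module.End ℝ (RSpace d)) (z : ℂ) :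
    z ∈ spectrum ℂ (complexMatrixHom d f) ↔ Module.End.HasEigenvalue (f.baseChange ℂ) z := by
  rw [complexMatrixHom_apply, AlgEquiv.spectrum_eq, Module.End.hasEigenvalue_iff_mem_spectrum]

/-- The powers of the inverse of an expansive dilation tend to `0`. -/
theorem IsExpansiveDilation.tendsto_symm_pow {d : ℕ} {A : RSpace d →ₗ[ℝ] RSpace d}
    (hA : IsExpansiveDilation A) :
    Tendsto (fun n : ℕ => LinearMap.toContinuousLinearMap
      (((hA.equiv.symm : RSpace d →ₗ[ℝ] RSpace d) : Module.End ℝ (RSpace d)) ^ n)) atTop (𝓝 0) := by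
  set B : Module.End ℝ (RSpace d) := (hA.equiv.symm : RSpace d →ₗ[ℝ] RSpace d) with hB
  rcases Nat.eq_zero_or_pos d with rfl | hd
  · have : Subsingleton (RSpace 0 →L[ℝ] RSpace 0) :=
      ⟨fun f g => by ext x i; exact i.elim0⟩
    exact tendsto_const_nhds.congr fun _ => Subsingleton.elim _ _
  have : Nonempty (Fin d) := ⟨⟨0, hd⟩⟩
  have hAB : (A : Module.End ℝ (RSpace d)) * B = 1 := by
    ext1 x; exact hA.equiv.apply_symm_apply x
  have hBA : B * (A : Module.End ℝ (RSpace d)) = 1 := by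
    ext1 x; exact hA.equiv.symm_apply_apply x
  let u : (Matrix (Fin d) (Fin d) ℂ)ˣ :=
    ⟨complexMatrixHom d A, complexMatrixHom d B, by rw [← map_mul, hAB, map_one],
      by rw [← map_mul, hBA, map_one]⟩
  have hspec : spectralRadius ℂ (complexMatrixHom d B) < 1 := by
    have := spectrum.spectralRadius_lt_of_forall_lt (complexMatrixHom d B) (r := 1) ?_
    · simpa using this
    intro z hz
    have hz' : z ∈ spectrum ℂ ((u⁻¹ : (Matrix (Fin d) (Fin d) ℂ)ˣ) : Matrix (Fin d) (Fin d) ℂ) := hz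
    -- The spectrum of an inverse consists of the reciprocals, here of the eigenvalues of $A$.
    rw [← spectrum.map_inv, Set.mem_inv] at hz'
    have h1 := hA.one_lt_norm _ ((spectrum_complexMatrixHom A z⁻¹).1 hz')
    rw [norm_inv] at h1
    have h2 : ‖z‖ < 1 := (one_lt_inv_iff₀.1 h1).2
    exact_mod_cast h2
  have hlim := tendsto_pow_zero_of_spectralRadius_lt_one hspec
  obtain ⟨ψ, hψ⟩ := LinearMap.exists_leftInverse_of_injective (complexMatrixHom d).toLinearMap
    (LinearMap.ker_eq_bot.2 (complexMatrixHom_injective d))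
  let Φ : Matrix (Fin d) (Fin d) ℂ →ₗ[ℝ] (RSpace d →L[ℝ] RSpace d) :=
    (LinearMap.toContinuousLinearMap (𝕜 := ℝ) (E := RSpace d) (F' := RSpace d)).toLinearMap ∘ₗ ψ
  have hΦ : Continuous Φ := LinearMap.continuous_of_finiteDimensional Φ
  have h3 := (hΦ.tendsto 0).comp hlim
  rw [map_zero] at h3
  refine h3.congr fun n => ?_
  have : ψ (complexMatrixHom d B ^ n) = B ^ n := by
    rw [← map_pow]; exact LinearMap.congr_fun hψ (B ^ n)
  simp [Φ, this]

/-- Points mapped into a fixed ball by a high power of the adjoint of an expansive dilation are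
close to the origin. -/
theorem IsExpansiveDilation.eventually_norm_lt {d : ℕ} {A : RSpace d →ₗ[ℝ] RSpace d}
    (hA : IsExpansiveDilation A) (r : ℝ) {ε : ℝ} (hε : 0 < ε) :
    ∀ᶠ j : ℕ in atTop, ∀ x : RSpace d, ‖(LinearMap.adjoint A ^ j) x‖ < r → ‖x‖ < ε := by
  have h1 : Tendsto (fun n : ℕ => ‖LinearMap.toContinuousLinearMap
      (((hA.equiv.symm : RSpace d →ₗ[ℝ] RSpace d) : Module.End ℝ (RSpace d)) ^ n)‖ * (|r| + 1))
      atTop (𝓝 0) := by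
    simpa using (hA.tendsto_symm_pow.norm).mul_const (|r| + 1)
  filter_upwards [h1.eventually_lt_const hε] with j hj x hx
  set B : Module.End ℝ (RSpace d) := (hA.equiv.symm : RSpace d →ₗ[ℝ] RSpace d) with hB
  set C := LinearMap.toContinuousLinearMap (B ^ j)
  have hAB : (A : Module.End ℝ (RSpace d)) * B = 1 := by
    ext1 x; exact hA.equiv.apply_symm_apply x
  have hBA : B * (A : Module.End ℝ (RSpace d)) = 1 := by
    ext1 x; exact hA.equiv.symm_apply_apply x
  have hcomm : Commute (A : Module.End ℝ (RSpace d)) B := hAB.trans hBA.symm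
  have hpow : (A : Module.End ℝ (RSpace d)) ^ j * B ^ j = 1 := by
    rw [← hcomm.mul_pow, hAB, one_pow]
  -- $\langle x,x\rangle=\langle A^{*j}x,A^{-j}x\rangle$, so the decay of $A^{-j}$ serves the
  -- adjoint without inverting it.
  have hnorm : ‖x‖ * ‖x‖ ≤ ‖C‖ * ‖(LinearMap.adjoint A ^ j) x‖ * ‖x‖ := by
    have h2 : inner ℝ ((LinearMap.adjoint A ^ j) x) (C x) = inner ℝ x x := by
      have h3 : LinearMap.adjoint A ^ j = LinearMap.adjoint (A ^ j) := by
        rw [← LinearMap.star_eq_adjoint, ← LinearMap.star_eq_adjoint, star_pow]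
      rw [h3, LinearMap.adjoint_inner_left]
      congr 1
      exact LinearMap.congr_fun hpow x
    calc ‖x‖ * ‖x‖ = inner ℝ x x := (real_inner_self_eq_norm_mul_norm x).symm
      _ = inner ℝ ((LinearMap.adjoint A ^ j) x) (C x) := h2.symm
      _ ≤ ‖(LinearMap.adjoint A ^ j) x‖ * ‖C x‖ := real_inner_le_norm _ _
      _ ≤ ‖(LinearMap.adjoint A ^ j) x‖ * (‖C‖ * ‖x‖) := by gcongr; exact C.le_opNorm x
      _ = _ := by ring
  rcases eq_or_ne x 0 with rfl | hx0
  · simpa using hε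
  have hpos : 0 < ‖x‖ := norm_pos_iff.2 hx0
  calc ‖x‖ ≤ ‖C‖ * ‖(LinearMap.adjoint A ^ j) x‖ := le_of_mul_le_mul_right hnorm hpos
    _ ≤ ‖C‖ * (|r| + 1) := by
      gcongr
      exact hx.le.trans ((le_abs_self r).trans (by linarith))
    _ < ε := hj

end Contraction

/-! ### Chebyshev's inequality and the exceptional set. -/

/-- If the averages of `L` over the sets `D j` are summable, then outside a set of vanishing relative
measure in `D j` the values of `L` on `D j` tend to `0` uniformly. -/
theorem exists_small_set_forall_lt {X : Type*} [MeasurableSpace X] {μ : Measure X} {D : ℕ → Set X}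
    (hD : ∀ j, MeasurableSet (D j)) {p V : ℝ≥0∞} {L : X → ℝ≥0∞}
    (hL : Measurable L) {a : ℕ → ℝ} (ha : Summable a) (ha0 : ∀ j, 0 ≤ a j)
    (haL : ∀ j, ∫⁻ x in D j, L x ∂μ ≤ p ^ j * V * ENNReal.ofReal (a j)) :
    ∃ (S : Set X) (c : ℕ → ℝ), MeasurableSet S ∧ Tendsto c atTop (𝓝 0) ∧
      (∀ j, ∀ x ∈ D j, x ∉ S → L x < ENNReal.ofReal (c j)) ∧
      ∀ j, μ (S ∩ D j) ≤ p ^ j * V * (ENNReal.ofReal (c j) * (1 - p)⁻¹) := by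
  -- The tail sum makes $c$ decreasing with $a_j\le c_j^2$; the term $1/(j+1)$ keeps $c_j$ positive,
  -- so that it can be cancelled.
  set c : ℕ → ℝ := fun j => √(∑' i, a (i + j)) + 1 / ((j : ℝ) + 1) with hc
  have hcpos : ∀ j, 0 < c j := fun j => by positivity
  have hsum : ∀ j, Summable fun i => a (i + j) := fun j => (summable_nat_add_iff j).2 ha
  have hac : ∀ j, a j ≤ c j * c j := by
    intro j
    have h1 : a j ≤ ∑' i, a (i + j) := by
      simpa using (hsum j).le_tsum 0 fun i _ => ha0 _
    have h2 : 0 ≤ ∑' i, a (i + j) := (ha0 j).trans h1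
    calc a j ≤ ∑' i, a (i + j) := h1
      _ = √(∑' i, a (i + j)) * √(∑' i, a (i + j)) := (Real.mul_self_sqrt h2).symm
      _ ≤ c j * c j := by
        have : √(∑' i, a (i + j)) ≤ c j := le_add_of_nonneg_right (by positivity)
        gcongr
  have hanti : Antitone c := by
    refine antitone_nat_of_succ_le fun j => ?_
    have h1 : ∑' i, a (i + (j + 1)) ≤ ∑' i, a (i + j) := by
      rw [(hsum j).tsum_eq_zero_add]
      have h2 : ∀ i, i + (j + 1) = i + 1 + j := fun i => by ring
      simp only [h2]
      exact le_add_of_nonneg_left (ha0 _)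
    have h3 : 1 / (((j + 1 : ℕ) : ℝ) + 1) ≤ 1 / ((j : ℝ) + 1) := by
      push_cast
      gcongr
      linarith
    exact add_le_add (Real.sqrt_le_sqrt h1) h3
  have hclim : Tendsto c atTop (𝓝 0) := by
    have h1 := (tendsto_sum_nat_add a).sqrt
    have h2 := h1.add tendsto_one_div_add_atTop_nhds_zero_nat
    simpa only [Real.sqrt_zero, add_zero] using h2
  have hpos : ∀ i, ENNReal.ofReal (c i) ≠ 0 := fun i => by simpa using hcpos i
  refine ⟨⋃ i, D i ∩ {x | ENNReal.ofReal (c i) ≤ L x}, c,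
    MeasurableSet.iUnion fun i => (hD i).inter (measurableSet_le measurable_const hL), hclim,
    fun j x hx hxS => ?_, fun j => ?_⟩
  · by_contra h
    exact hxS (Set.mem_iUnion.2 ⟨j, hx, not_lt.1 h⟩)
  have hcheb : ∀ i, μ (D i ∩ {x | ENNReal.ofReal (c i) ≤ L x}) ≤
      p ^ i * V * ENNReal.ofReal (c i) := by
    intro i
    have h1 : ENNReal.ofReal (c i) * μ (D i ∩ {x | ENNReal.ofReal (c i) ≤ L x}) ≤
        p ^ i * V * ENNReal.ofReal (a i) := by
      refine le_trans ?_ (haL i)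
      have := mul_meas_ge_le_lintegral (μ := μ.restrict (D i)) hL (ENNReal.ofReal (c i))
      rwa [Measure.restrict_apply (measurableSet_le measurable_const hL), Set.inter_comm] at this
    have h2 : ENNReal.ofReal (a i) ≤ ENNReal.ofReal (c i) * ENNReal.ofReal (c i) := by
      rw [← ENNReal.ofReal_mul (hcpos i).le]
      exact ENNReal.ofReal_le_ofReal (hac i)
    refine (ENNReal.mul_le_mul_iff_right (hpos i) ENNReal.ofReal_ne_top).1 ?_
    calc _ ≤ p ^ i * V * ENNReal.ofReal (a i) := h1
      _ ≤ p ^ i * V * (ENNReal.ofReal (c i) * ENNReal.ofReal (c i)) := by gcongr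
      _ = _ := by ring
  -- Pieces with $i\le j$ are absorbed by the piece of index $j$, since $c_j\le c_i$; the sets $D_j$
  -- need not be nested.
  have hsub : (⋃ i, D i ∩ {x | ENNReal.ofReal (c i) ≤ L x}) ∩ D j ⊆
      ⋃ i, D (i + j) ∩ {x | ENNReal.ofReal (c (i + j)) ≤ L x} := by
    rintro x ⟨hx, hxj⟩
    obtain ⟨i, hxi, hLi⟩ := Set.mem_iUnion.1 hx
    rw [Set.mem_iUnion]
    rcases le_total i j with hij | hij
    · refine ⟨0, by simpa using hxj, ?_⟩
      have : ENNReal.ofReal (c j) ≤ L x :=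
        (ENNReal.ofReal_le_ofReal (hanti hij)).trans hLi
      simpa using this
    · refine ⟨i - j, ?_⟩
      rw [Nat.sub_add_cancel hij]
      exact ⟨hxi, hLi⟩
  calc μ ((⋃ i, D i ∩ {x | ENNReal.ofReal (c i) ≤ L x}) ∩ D j)
      ≤ ∑' i, μ (D (i + j) ∩ {x | ENNReal.ofReal (c (i + j)) ≤ L x}) :=
        (measure_mono hsub).trans (measure_iUnion_le _)
    _ ≤ ∑' i, p ^ i * (p ^ j * V * ENNReal.ofReal (c j)) := by
        refine ENNReal.tsum_le_tsum fun i => (hcheb (i + j)).trans ?_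
        calc p ^ (i + j) * V * ENNReal.ofReal (c (i + j))
            ≤ p ^ (i + j) * V * ENNReal.ofReal (c j) := by
              gcongr
              exact hanti (Nat.le_add_left j i)
          _ = _ := by ring
    _ = p ^ j * V * (ENNReal.ofReal (c j) * (1 - p)⁻¹) := by
        -- The formula holds for every $p$: when $p\ge1$ both sides of the geometric sum are
        -- $\infty$.
        rw [ENNReal.tsum_mul_right, ENNReal.tsum_geometric]
        ring

/-! ### Determinants and volumes of dilated sets. -/

theorem det_adjoint {d : ℕ} (A : RSpace d →ₗ[ℝ] RSpace d) :
    LinearMap.det (LinearMap.adjoint A) = LinearMap.det A := by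
  let b := EuclideanSpace.basisFun (Fin d) ℝ
  rw [← LinearMap.det_toMatrix b.toBasis, ← LinearMap.det_toMatrix b.toBasis,
    LinearMap.toMatrix_adjoint b b, Matrix.det_conjTranspose, star_trivial]

/-- The volume of the preimage of a set under a power of an invertible linear map. -/
theorem volume_preimage_pow {d : ℕ} {T : RSpace d →ₗ[ℝ] RSpace d} (hT : LinearMap.det T ≠ 0)
    (j : ℕ) (s : Set (RSpace d)) :
    volume ((T ^ j : Module.End ℝ (RSpace d)) ⁻¹' s) =
      ENNReal.ofReal |(LinearMap.det T)⁻¹| ^ j * volume s := by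
  rw [Measure.addHaar_preimage_linearMap volume (by rw [map_pow]; exact pow_ne_zero _ hT), map_pow,
    ← inv_pow, abs_pow, ENNReal.ofReal_pow (abs_nonneg _)]

theorem IsExpansiveDilation.det_ne_zero {d : ℕ} {A : RSpace d →ₗ[ℝ] RSpace d}
    (hA : IsExpansiveDilation A) : LinearMap.det A ≠ 0 :=
  (LinearEquiv.isUnit_det' hA.equiv).ne_zero

/-- The determinant of an expansive dilation has modulus greater than `1`. -/
theorem IsExpansiveDilation.one_lt_abs_det {d : ℕ} (hd : 0 < d) {A : RSpace d →ₗ[ℝ] RSpace d}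
    (hA : IsExpansiveDilation A) : 1 < |LinearMap.det A| := by
  -- Some $T^{-j}B_1$ lies in $B_{1/2}$; comparing volumes, $|\det A|^{-j}\le2^{-d}<1$.
  obtain ⟨j, hj⟩ := (hA.eventually_norm_lt 1 (ε := 1 / 2) (by norm_num)).exists
  have hT : LinearMap.det (LinearMap.adjoint A) ≠ 0 := by
    rw [det_adjoint]; exact hA.det_ne_zero
  have hne : Nonempty (Fin d) := ⟨⟨0, hd⟩⟩
  have h1 : ENNReal.ofReal |(LinearMap.det (LinearMap.adjoint A))⁻¹| ^ j *
      volume (Metric.ball (0 : RSpace d) 1) ≤ volume (Metric.ball (0 : RSpace d) (1 / 2)) := by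
    rw [← volume_preimage_pow hT]
    exact measure_mono fun x hx => by simpa using hj x (by simpa using hx)
  rw [Measure.addHaar_ball volume (0 : RSpace d) (by norm_num : (0 : ℝ) ≤ 1 / 2),
    finrank_euclideanSpace_fin] at h1
  have h2 := (ENNReal.mul_le_mul_iff_left (Metric.measure_ball_pos volume _ one_pos).ne'
    measure_ball_lt_top.ne).1 h1
  rw [← ENNReal.ofReal_pow (abs_nonneg _), ENNReal.ofReal_le_ofReal_iff (by positivity),
    det_adjoint, abs_inv, inv_pow] at h2
  by_contra h
  have h3 : |LinearMap.det A| ^ j ≤ 1 := pow_le_one₀ (abs_nonneg _) (not_lt.1 h)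
  have h4 : 1 ≤ (|LinearMap.det A| ^ j)⁻¹ :=
    (one_le_inv₀ (pow_pos (abs_pos.2 hA.det_ne_zero) _)).2 h3
  have h5 : (1 / 2 : ℝ) ^ d < 1 := pow_lt_one₀ (by norm_num) (by norm_num) hd.ne'
  linarith

/-! ### From summable averages to approximate continuity. -/

/-- Approximate continuity at the origin, with value `0`, of a function whose averages over the
dilated balls tend to `0` summably. -/
theorem isApproxContinuousAtOrigin_of_summable {d : ℕ} {A : RSpace d →ₗ[ℝ] RSpace d}
    (hA : IsExpansiveDilation A) {φ : RSpace d → ℂ} (hφ : Measurable φ)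
    {a : ℕ → ℝ} (ha : Summable a) (ha0 : ∀ j, 0 ≤ a j)
    (haφ : ∀ j : ℕ, ∫⁻ x in (LinearMap.adjoint A ^ j : Module.End ℝ (RSpace d)) ⁻¹'
        Metric.ball 0 1, ‖φ x‖ₑ ^ 2 ≤
      ENNReal.ofReal |(LinearMap.det A)⁻¹| ^ j * volume (Metric.ball (0 : RSpace d) 1) *
        ENNReal.ofReal (a j))
    {g : RSpace d → ℂ} (hg : g =ᵐ[volume] φ) (hg0 : g 0 = 0) :
    IsApproxContinuousAtOrigin (LinearMap.adjoint A) g := by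
  -- In dimension $0$ the determinant is $1$ and the geometric series diverges, but the space is a
  -- point.
  rcases Nat.eq_zero_or_pos d with rfl | hd
  · have hs : Subsingleton (RSpace 0) := ⟨fun x y => by ext i; exact i.elim0⟩
    refine ⟨Set.univ, MeasurableSet.univ, ?_, fun r hr => ?_, ?_⟩
    · exact Measure.measure_univ_pos.2 (NeZero.ne _)
    · refine tendsto_const_nhds.congr fun j => ?_
      have h0 : (LinearMap.adjoint A ^ j : Module.End ℝ (RSpace 0)) ⁻¹' Metric.ball 0 r =
          Metric.ball 0 r := by
        ext x; rw [Set.mem_preimage, Subsingleton.elim ((LinearMap.adjoint A ^ j) x) x]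
      rw [Set.univ_inter, h0, ENNReal.div_self (Metric.measure_ball_pos volume _ hr).ne'
        measure_ball_lt_top.ne]
    · have : g = fun _ => g 0 := funext fun x => by rw [Subsingleton.elim x 0]
      rw [this]; exact tendsto_const_nhds
  set T := LinearMap.adjoint A with hTdef
  have hT : LinearMap.det T ≠ 0 := by rw [hTdef, det_adjoint]; exact hA.det_ne_zero
  set p : ℝ≥0∞ := ENNReal.ofReal |(LinearMap.det A)⁻¹| with hp
  have hp1 : p < 1 := by
    rw [hp, ENNReal.ofReal_lt_one, abs_inv]
    exact inv_lt_one_of_one_lt₀ (hA.one_lt_abs_det hd)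
  have hp0 : p ≠ 0 := by
    rw [hp]; simpa using hA.det_ne_zero
  have hvol : ∀ (j : ℕ) (s : Set (RSpace d)),
      volume ((T ^ j : Module.End ℝ (RSpace d)) ⁻¹' s) = p ^ j * volume s := by
    intro j s
    rw [volume_preimage_pow hT, hTdef, det_adjoint]
  have hTc : ∀ j : ℕ, Continuous (T ^ j : Module.End ℝ (RSpace d)) := fun j =>
    LinearMap.continuous_of_finiteDimensional _
  obtain ⟨S, c, hS, hc, hcS, hSD⟩ := exists_small_set_forall_lt (μ := volume)
    (D := fun j => (T ^ j : Module.End ℝ (RSpace d)) ⁻¹' Metric.ball 0 1)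
    (fun j => (hTc j).measurable measurableSet_ball)
    (L := fun x => ‖φ x‖ₑ ^ 2) (hφ.enorm.pow_const 2) ha ha0 haφ
  set V := volume (Metric.ball (0 : RSpace d) 1)
  -- As $g$ need not be measurable, a measurable null hull of the set where it differs from
  -- $\varphi$ is removed.
  set N := toMeasurable volume {x | g x ≠ φ x} with hN
  have hN0 : volume N = 0 := by rw [hN, measure_toMeasurable]; exact hg
  have hNm : MeasurableSet N := measurableSet_toMeasurable _ _
  have hdens : IsDensityPoint T (S ∪ N)ᶜ := by
    intro r hr
    -- $T^{-m}B_r\subseteq B_1$, hence $T^{-j}B_r\subseteq T^{-(j-m)}B_1$ for $j\ge m$; the shift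
    -- costs only the constant factor $p^{-m}$ in $K$.
    obtain ⟨m, hm⟩ := (hA.eventually_norm_lt r one_pos).exists
    set W := volume (Metric.ball (0 : RSpace d) r) with hW
    have hW0 : W ≠ 0 := (Metric.measure_ball_pos volume _ hr).ne'
    have hWt : W ≠ ∞ := measure_ball_lt_top.ne
    set K := V * (1 - p)⁻¹ / (p ^ m * W) with hK
    have hKt : K ≠ ∞ := by
      refine ENNReal.div_ne_top (ENNReal.mul_ne_top measure_ball_lt_top.ne
        (ENNReal.inv_ne_top.2 (tsub_pos_of_lt hp1).ne')) (mul_ne_zero (pow_ne_zero _ hp0) hW0)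
    have hlow : Tendsto (fun j : ℕ => 1 - ENNReal.ofReal (c (j - m)) * K) atTop (𝓝 1) := by
      have h1 : Tendsto (fun j : ℕ => ENNReal.ofReal (c (j - m)) * K) atTop (𝓝 0) := by
        have h2 : Tendsto (fun j : ℕ => ENNReal.ofReal (c (j - m))) atTop (𝓝 0) := by
          simpa using ENNReal.tendsto_ofReal (hc.comp (tendsto_sub_atTop_nat m))
        simpa using ENNReal.Tendsto.mul_const h2 (Or.inr hKt)
      simpa using ENNReal.Tendsto.sub (tendsto_const_nhds (x := (1 : ℝ≥0∞))) h1
        (Or.inl ENNReal.one_ne_top)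
    refine tendsto_of_tendsto_of_tendsto_of_le_of_le' hlow tendsto_const_nhds ?_
      (Eventually.of_forall fun j => ?_)
    · filter_upwards [eventually_ge_atTop m] with j hj
      set B := (T ^ j : Module.End ℝ (RSpace d)) ⁻¹' Metric.ball 0 r with hB
      have hBvol : volume B = p ^ j * W := hvol j _
      have hB0 : volume B ≠ 0 := by
        rw [hBvol]; exact mul_ne_zero (pow_ne_zero _ hp0) hW0
      have hBt : volume B ≠ ∞ := by
        rw [hBvol]; exact ENNReal.mul_ne_top (ENNReal.pow_ne_top hp1.ne_top) hWt
      have hsub : B ⊆ (T ^ (j - m) : Module.End ℝ (RSpace d)) ⁻¹' Metric.ball 0 1 := by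
        intro x hx
        have hx' : ‖(T ^ j) x‖ < r := by simpa [hB] using hx
        have : (T ^ j) x = (T ^ m) ((T ^ (j - m)) x) := by
          rw [← Module.End.mul_apply, ← pow_add, Nat.add_sub_cancel' hj]
        rw [this] at hx'
        simpa using hm _ hx'
      have hbad : volume ((S ∪ N) ∩ B) ≤ p ^ (j - m) * V *
          (ENNReal.ofReal (c (j - m)) * (1 - p)⁻¹) := by
        refine le_trans ?_ (hSD (j - m))
        rw [Set.union_inter_distrib_right]
        refine (measure_union_le _ _).trans ?_
        rw [measure_mono_null Set.inter_subset_left hN0, add_zero]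
        exact measure_mono (Set.inter_subset_inter_right _ hsub)
      have hsplit : volume B ≤ volume ((S ∪ N)ᶜ ∩ B) + volume ((S ∪ N) ∩ B) := by
        refine le_trans (measure_mono fun x hx => ?_) (measure_union_le _ _)
        by_cases h : x ∈ S ∪ N
        · exact Or.inr ⟨h, hx⟩
        · exact Or.inl ⟨h, hx⟩
      have hratio : volume ((S ∪ N) ∩ B) / volume B ≤ ENNReal.ofReal (c (j - m)) * K := by
        rw [ENNReal.div_le_iff hB0 hBt, hBvol]
        refine hbad.trans (le_of_eq ?_)
        have h1 : p ^ j = p ^ (j - m) * p ^ m := by rw [← pow_add, Nat.sub_add_cancel hj]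
        have h2 : K * (p ^ m * W) = V * (1 - p)⁻¹ :=
          ENNReal.div_mul_cancel (mul_ne_zero (pow_ne_zero _ hp0) hW0)
            (ENNReal.mul_ne_top (ENNReal.pow_ne_top hp1.ne_top) hWt)
        calc p ^ (j - m) * V * (ENNReal.ofReal (c (j - m)) * (1 - p)⁻¹)
            = p ^ (j - m) * ENNReal.ofReal (c (j - m)) * (V * (1 - p)⁻¹) := by ring
          _ = p ^ (j - m) * ENNReal.ofReal (c (j - m)) * (K * (p ^ m * W)) := by rw [h2]
          _ = _ := by rw [h1]; ring
      rw [tsub_le_iff_right]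
      calc (1 : ℝ≥0∞) = volume B / volume B := (ENNReal.div_self hB0 hBt).symm
        _ ≤ (volume ((S ∪ N)ᶜ ∩ B) + volume ((S ∪ N) ∩ B)) / volume B := by gcongr
        _ = volume ((S ∪ N)ᶜ ∩ B) / volume B + volume ((S ∪ N) ∩ B) / volume B :=
          ENNReal.add_div
        _ ≤ _ := by gcongr
    · exact ENNReal.div_le_of_le_mul (by rw [one_mul]; exact measure_mono Set.inter_subset_right)
  refine ⟨(S ∪ N)ᶜ, (hS.union hNm).compl, ?_, hdens, ?_⟩
  · rw [pos_iff_ne_zero]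
    intro h0
    obtain ⟨j, hj⟩ := ((hdens 1 one_pos).eventually_ne one_ne_zero).exists
    refine hj ?_
    rw [measure_mono_null Set.inter_subset_left h0, ENNReal.zero_div]
  · rw [hg0, tendsto_zero_iff_norm_tendsto_zero, Metric.tendsto_nhds]
    intro ε hε
    -- The thresholds bound $|\varphi|^2$, hence the comparison with $\varepsilon^2$.
    obtain ⟨j, hj⟩ := (hc.eventually_lt_const (pow_pos hε 2)).exists
    have hnhds : (T ^ j : Module.End ℝ (RSpace d)) ⁻¹' Metric.ball 0 1 ∈ 𝓝 (0 : RSpace d) :=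
      (hTc j).continuousAt.preimage_mem_nhds (by
        rw [map_zero]; exact Metric.ball_mem_nhds _ one_pos)
    filter_upwards [nhdsWithin_le_nhds hnhds, self_mem_nhdsWithin] with x hx hxS
    have hxN : g x = φ x := by
      by_contra h
      exact hxS (Or.inr (subset_toMeasurable _ _ h))
    have h1 : ‖φ x‖ₑ ^ 2 < ENNReal.ofReal (ε ^ 2) :=
      (hcS j x hx fun h => hxS (Or.inl h)).trans_le (ENNReal.ofReal_le_ofReal hj.le)
    rw [← ofReal_norm, ← ENNReal.ofReal_pow (norm_nonneg _),
      ENNReal.ofReal_lt_ofReal_iff (pow_pos hε 2)] at h1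
    rw [hxN, dist_zero_right, norm_norm]
    exact lt_of_pow_lt_pow_left₀ 2 hε.le h1

/-! ### Parseval's identity on the unit cube. -/

section Parseval

attribute [local instance] instMeasureSpaceUnitAddCircle
  instIsAddHaarMeasureUnitAddCircleVolume instIsProbabilityMeasureUnitAddCircleVolume

open UnitAddTorus in
/-- **Parseval's identity** for a square integrable function supported in the unit cube centred at
the origin. -/
theorem hasSum_sq_norm_integral_cube {d : ℕ} {F : RSpace d → ℂ} (hF : MemLp F 2 volume)
    (hsupp : ∀ x, F x ≠ 0 → ∀ i, |x i| < 1 / 2) :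
    HasSum (fun k : Fin d → ℤ => ‖∫ x : RSpace d,
        Complex.exp ((2 * Real.pi * inner ℝ x (latticePoint k) : ℝ) * Complex.I) * F x‖ ^ 2)
      (∫ x : RSpace d, ‖F x‖ ^ 2) := by
  set a : Fin d → ℝ := fun _ => -(1 / 2) with ha
  set Q : Set (Fin d → ℝ) := {x | ∀ i, x i ∈ Set.Ioc (a i) (a i + 1)} with hQ
  have hQm : MeasurableSet Q := MeasurableSet.univ_pi' fun i => measurableSet_Ioc
  let P : UnitAddTorus (Fin d) → (Fin d → ℝ) := fun t => (measurableEquivPiIoc a t).1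
  let G : (Fin d → ℝ) → ℂ := fun y => F (WithLp.toLp 2 y)
  have hG : MemLp G 2 volume :=
    hF.comp_measurePreserving (PiLp.volume_preserving_toLp (Fin d))
  have hGQ : ∀ y, y ∉ Q → G y = 0 := by
    intro y hy
    by_contra h
    refine hy fun i => ?_
    have := abs_lt.1 (hsupp _ h i)
    simp only [ha] at this ⊢
    constructor
    · exact this.1
    · have := this.2; simp at this; linarith
  have hGm : MemLp (fun t => G (P t)) 2 (volume : Measure (UnitAddTorus (Fin d))) := by
    have h1 : MemLp (fun y : Q => G y) 2 (Measure.comap Subtype.val volume) := by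
      have h2 : MemLp G 2 (Measure.map (Subtype.val : Q → _) (Measure.comap Subtype.val volume)) := by
        rw [map_comap_subtype_coe hQm]
        exact hG.restrict Q
      exact h2.comp_of_map measurable_subtype_coe.aemeasurable
    exact h1.comp_measurePreserving (measurePreserving_equivPiIoc a)
  have hPk : ∀ y ∈ Q, P (fun i => (y i : UnitAddCircle)) = y := by
    intro y hy
    have := (measurableEquivPiIoc a).apply_symm_apply ⟨y, hy⟩
    rw [coe_symm_measurableEquivPiIoc_apply] at this
    exact congrArg Subtype.val this
  have hcube : ∀ H : RSpace d → ℂ, (∀ x, H x ≠ 0 → F x ≠ 0) →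
      ∫ x, H x = ∫ y in Q, H (WithLp.toLp 2 y) := by
    intro H hH
    rw [setIntegral_eq_integral_of_forall_compl_eq_zero]
    · exact ((PiLp.volume_preserving_toLp (Fin d)).integral_comp
        (MeasurableEquiv.toLp 2 (Fin d → ℝ)).measurableEmbedding H).symm
    · intro y hy
      by_contra h
      exact hH _ h (hGQ y hy)
  -- The $n$-th torus coefficient integrates against $e^{-2\pi i n\cdot x}$, hence the sign, undone
  -- at the end by reindexing.
  have hcoeff : ∀ k : Fin d → ℤ, mFourierCoeff hGm.toLp (-k) = ∫ x : RSpace d,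
        Complex.exp ((2 * Real.pi * inner ℝ x (latticePoint k) : ℝ) * Complex.I) * F x := by
    intro k
    have h1 : mFourierCoeff hGm.toLp (-k) = mFourierCoeff (fun t => G (P t)) (-k) := by
      apply integral_congr_ae
      filter_upwards [hGm.coeFn_toLp] with t ht
      rw [ht]
    rw [h1, mFourierCoeff_eq_integral _ _ a, hcube _ fun x hx => right_ne_zero_of_mul hx]
    refine setIntegral_congr_fun hQm fun y hy => ?_
    simp only [neg_neg, smul_eq_mul]
    rw [hPk y hy]
    congr 1
    simp only [mFourier, ContinuousMap.coe_mk, fourier_coe_apply]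
    rw [← Complex.exp_sum]
    congr 1
    simp only [latticePoint, PiLp.inner_apply, RCLike.inner_apply, conj_trivial]
    push_cast
    rw [Finset.mul_sum, Finset.sum_mul]
    refine Finset.sum_congr rfl fun i _ => ?_
    ring
  have hnorm : ∫ t, ‖hGm.toLp _ t‖ ^ 2 = ∫ x : RSpace d, ‖F x‖ ^ 2 := by
    have h1 : ∫ t, ‖hGm.toLp _ t‖ ^ 2 = ∫ t, ‖G (P t)‖ ^ 2 := by
      apply integral_congr_ae
      filter_upwards [hGm.coeFn_toLp] with t ht
      rw [ht]
    rw [h1, integral_preimage _ a]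
    have h2 : ∫ x : RSpace d, ‖F x‖ ^ 2 = ∫ y in Q, ‖G y‖ ^ 2 := by
      rw [setIntegral_eq_integral_of_forall_compl_eq_zero]
      · exact ((PiLp.volume_preserving_toLp (Fin d)).integral_comp
          (MeasurableEquiv.toLp 2 (Fin d → ℝ)).measurableEmbedding _).symm
      · intro y hy
        simp [hGQ y hy]
    rw [h2]
    refine setIntegral_congr_fun hQm fun y hy => ?_
    simp only [hPk y hy]
  have hsum := hasSum_sq_mFourierCoeff hGm.toLp
  rw [hnorm, ← (Equiv.neg (Fin d → ℤ)).hasSum_iff] at hsum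
  refine hsum.congr_fun fun k => ?_
  simp only [Function.comp_apply, Equiv.neg_apply, hcoeff]

end Parseval

/-! ### Affine coefficients on the Fourier side. -/

/-- Change of variables for an invertible affine map. -/
theorem integral_comp_linearEquiv_sub {d : ℕ} (U : RSpace d ≃ₗ[ℝ] RSpace d) (v : RSpace d)
    (h : RSpace d → ℂ) :
    ∫ x, h (U x - v) = ((|LinearMap.det (U : RSpace d →ₗ[ℝ] RSpace d)|⁻¹ : ℝ) : ℂ) * ∫ x, h x := by
  have hmap := Measure.map_linearMap_addHaar_eq_smul_addHaar
    (volume : Measure (RSpace d)) (f := (U : RSpace d →ₗ[ℝ] RSpace d))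
    (LinearEquiv.isUnit_det' U).ne_zero
  have hemb : MeasurableEmbedding U :=
    U.toContinuousLinearEquiv.toHomeomorph.measurableEmbedding
  have h1 : ∫ x, h (U x - v) =
      ∫ y, h (y - v) ∂(Measure.map (U : RSpace d →ₗ[ℝ] RSpace d) volume) :=
    (hemb.integral_map fun y => h (y - v)).symm
  rw [h1, hmap, integral_smul_measure, integral_sub_right_eq_self,
    ENNReal.toReal_ofReal (abs_nonneg _), abs_inv, Complex.real_smul]

/-- A modulated dilate of a smooth compactly supported function. -/
noncomputable def modulatedDilate {d : ℕ} (b : RSpace d → ℂ) (S : RSpace d ≃ₗ[ℝ] RSpace d)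
    (v : RSpace d) (η : RSpace d) : ℂ :=
  Complex.exp ((2 * Real.pi * inner ℝ η v : ℝ) * Complex.I) * b (S η)

theorem hasCompactSupport_modulatedDilate {d : ℕ} {b : RSpace d → ℂ} (hb : HasCompactSupport b)
    (S : RSpace d ≃ₗ[ℝ] RSpace d) (v : RSpace d) : HasCompactSupport (modulatedDilate b S v) :=
  (hb.comp_homeomorph S.toContinuousLinearEquiv.toHomeomorph).mul_left

theorem contDiff_modulatedDilate {d : ℕ} {b : RSpace d → ℂ} (hb : ContDiff ℝ (⊤ : ℕ∞) b)
    (S : RSpace d ≃ₗ[ℝ] RSpace d) (v : RSpace d) :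
    ContDiff ℝ (⊤ : ℕ∞) (modulatedDilate b S v) := by
  have h1 : ContDiff ℝ (⊤ : ℕ∞) fun η => b (S η) := hb.comp S.toContinuousLinearEquiv.contDiff
  have h2 : ContDiff ℝ (⊤ : ℕ∞) fun η : RSpace d => ((2 * Real.pi * inner ℝ η v : ℝ) : ℂ) :=
    Complex.ofRealCLM.contDiff.comp (contDiff_const.mul (contDiff_id.inner ℝ contDiff_const))
  exact ((h2.mul contDiff_const).cexp).mul h1

/-- The inverse Fourier transform intertwines modulated dilates and affine substitutions. -/
theorem fourierInv_modulatedDilate {d : ℕ} (b : RSpace d → ℂ) (U S : RSpace d ≃ₗ[ℝ] RSpace d)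
    (hUS : ∀ x y, inner ℝ (S x) y = inner ℝ x (U y)) (v x : RSpace d) :
    𝓕⁻ (modulatedDilate b S v) (U x - v) =
      ((|LinearMap.det (S : RSpace d →ₗ[ℝ] RSpace d)|⁻¹ : ℝ) : ℂ) * 𝓕⁻ b x := by
  rw [Real.fourierInv_eq', Real.fourierInv_eq', ← sub_zero x]
  have h := integral_comp_linearEquiv_sub S 0
    fun η => Complex.exp ((2 * Real.pi * inner ℝ η x : ℝ) * Complex.I) • b η
  simp only [sub_zero] at h ⊢
  rw [← h]
  -- The modulation cancels the translation: $\langle\eta,v\rangle+\langle\eta,Ux-v\rangle=\langle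
  -- S\eta,x\rangle$.
  refine integral_congr_ae (Eventually.of_forall fun η => ?_)
  simp only [modulatedDilate, smul_eq_mul, ← mul_assoc, ← Complex.exp_add, hUS]
  congr 2
  rw [inner_sub_right]
  push_cast
  ring

/-- The coefficients of a function with Fourier transform `b` with respect to an affinely
transformed square integrable function, on the Fourier side. -/
theorem integral_conj_affine_mul_fourierInv {d : ℕ} {b : RSpace d → ℂ} (hbc : HasCompactSupport b)
    (hb : ContDiff ℝ (⊤ : ℕ∞) b) (U S : RSpace d ≃ₗ[ℝ] RSpace d)
    (hUS : ∀ x y, inner ℝ (S x) y = inner ℝ x (U y))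
    (hdet : LinearMap.det (S : RSpace d →ₗ[ℝ] RSpace d) =
      LinearMap.det (U : RSpace d →ₗ[ℝ] RSpace d)) (v : RSpace d) (ψ : L2 d) :
    ∫ x, starRingEnd ℂ (ψ (U x - v)) * 𝓕⁻ b x =
      ∫ η, Complex.exp ((2 * Real.pi * inner ℝ η v : ℝ) * Complex.I) *
        (b (S η) * starRingEnd ℂ ((𝓕 ψ : L2 d) η)) := by
  set H : SchwartzMap (RSpace d) ℂ := (hasCompactSupport_modulatedDilate hbc S v).toSchwartzMap
    (contDiff_modulatedDilate hb S v) with hH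
  have hHapp : ∀ η, H η = modulatedDilate b S v η := fun η => rfl
  have hdet0 : |LinearMap.det (U : RSpace d →ₗ[ℝ] RSpace d)| ≠ 0 :=
    abs_ne_zero.2 (LinearEquiv.isUnit_det' U).ne_zero
  -- With the test function written in the variable $Ux-v$, the affine map acts on smooth functions
  -- only, and no transform of an affinely changed $L^2$ function is needed.
  have h1 : ∀ x, 𝓕⁻ b x = ((|LinearMap.det (U : RSpace d →ₗ[ℝ] RSpace d)| : ℝ) : ℂ) *
      𝓕⁻ (modulatedDilate b S v) (U x - v) := by
    intro x
    rw [fourierInv_modulatedDilate b U S hUS, hdet, ← mul_assoc, ← Complex.ofReal_mul,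
      mul_inv_cancel₀ hdet0, Complex.ofReal_one, one_mul]
  have h2 : ∫ x, starRingEnd ℂ (ψ (U x - v)) * 𝓕⁻ b x =
      ∫ y, starRingEnd ℂ (ψ y) * 𝓕⁻ (modulatedDilate b S v) y := by
    have h3 := integral_comp_linearEquiv_sub U v
      fun y => starRingEnd ℂ (ψ y) * 𝓕⁻ (modulatedDilate b S v) y
    have h4 : ∀ x, starRingEnd ℂ (ψ (U x - v)) * 𝓕⁻ b x =
        ((|LinearMap.det (U : RSpace d →ₗ[ℝ] RSpace d)| : ℝ) : ℂ) *
          (starRingEnd ℂ (ψ (U x - v)) * 𝓕⁻ (modulatedDilate b S v) (U x - v)) := fun x => by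
      rw [h1]; ring
    simp only [h4]
    rw [integral_const_mul, h3, ← mul_assoc, ← Complex.ofReal_mul, mul_inv_cancel₀ hdet0,
      Complex.ofReal_one, one_mul]
  have h5 : inner ℂ ψ ((𝓕⁻ H).toLp 2) = ∫ y, starRingEnd ℂ (ψ y) * 𝓕⁻ (modulatedDilate b S v) y := by
    rw [L2.inner_def]
    refine integral_congr_ae ?_
    filter_upwards [(𝓕⁻ H).coeFn_toLp 2] with y hy
    rw [hy, RCLike.inner_apply, mul_comm, SchwartzMap.fourierInv_coe]
    rfl
  -- Plancherel's theorem; $H$ being Schwartz, Fourier inversion is pointwise.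
  have h6 : inner ℂ ψ ((𝓕⁻ H).toLp 2) = inner ℂ (𝓕 ψ : L2 d) (H.toLp 2) := by
    rw [← Lp.inner_fourier_eq, SchwartzMap.toLp_fourier_eq, FourierTransform.fourier_fourierInv_eq]
  rw [h2, ← h5, h6, L2.inner_def]
  refine integral_congr_ae ?_
  filter_upwards [H.coeFn_toLp 2] with η hη
  rw [hη, RCLike.inner_apply, hHapp, modulatedDilate, mul_assoc]

theorem IsExpansiveDilation.equiv_pow_apply {d : ℕ} {A : RSpace d →ₗ[ℝ] RSpace d}
    (hA : IsExpansiveDilation A) (j : ℕ) (x : RSpace d) :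
    (hA.equiv ^ j) x = (A ^ j : Module.End ℝ (RSpace d)) x := by
  induction j generalizing x with
  | zero => rfl
  | succ n ih => rw [pow_succ, pow_succ, LinearEquiv.mul_apply, ih]; rfl

theorem adjoint_pow {d : ℕ} (A : RSpace d →ₗ[ℝ] RSpace d) (j : ℕ) :
    LinearMap.adjoint A ^ j = LinearMap.adjoint (A ^ j : Module.End ℝ (RSpace d)) := by
  rw [← LinearMap.star_eq_adjoint, ← LinearMap.star_eq_adjoint, star_pow]

/-- The Fourier side expression of the coefficients of a band-limited function with respect to
the elements of an affine system. -/
theorem norm_sq_inner_affineElement {d : ℕ} {A : RSpace d →ₗ[ℝ] RSpace d}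
    (hA : IsExpansiveDilation A) {b : RSpace d → ℂ} (hbc : HasCompactSupport b)
    (hb : ContDiff ℝ (⊤ : ℕ∞) b) (ψ : L2 d) (j : ℕ) (k : Fin d → ℤ) :
    ‖inner ℂ (affineElement hA ψ j k) ((𝓕⁻ (hbc.toSchwartzMap hb)).toLp 2)‖ ^ 2 =
      |LinearMap.det A| ^ j * ‖∫ η : RSpace d,
        Complex.exp ((2 * Real.pi * inner ℝ η (latticePoint k) : ℝ) * Complex.I) *
        (b ((LinearMap.adjoint A ^ j : Module.End ℝ (RSpace d)) η) *
          starRingEnd ℂ ((𝓕 ψ : L2 d) η))‖ ^ 2 := by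
  set U : RSpace d ≃ₗ[ℝ] RSpace d := hA.equiv ^ j with hU
  have hUA : (U : RSpace d →ₗ[ℝ] RSpace d) = (A ^ j : Module.End ℝ (RSpace d)) :=
    LinearMap.ext fun x => hA.equiv_pow_apply j x
  have hdet0 : LinearMap.det (LinearMap.adjoint A ^ j : Module.End ℝ (RSpace d)) ≠ 0 := by
    rw [map_pow, det_adjoint]; exact pow_ne_zero _ hA.det_ne_zero
  set S : RSpace d ≃ₗ[ℝ] RSpace d := LinearEquiv.ofIsUnitDet
    (f := (LinearMap.adjoint A ^ j : Module.End ℝ (RSpace d)))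
    (v := (EuclideanSpace.basisFun (Fin d) ℝ).toBasis)
    (v' := (EuclideanSpace.basisFun (Fin d) ℝ).toBasis)
    (by rw [LinearMap.det_toMatrix]; exact hdet0.isUnit) with hS
  have hSA : (S : RSpace d →ₗ[ℝ] RSpace d) = LinearMap.adjoint A ^ j := by
    ext1 x; rfl
  have hUS : ∀ x y, inner ℝ (S x) y = inner ℝ x (U y) := by
    intro x y
    have h1 : S x = LinearMap.adjoint (A ^ j : Module.End ℝ (RSpace d)) x := by
      rw [← adjoint_pow]; rfl
    rw [h1, LinearMap.adjoint_inner_left, ← hUA]; rfl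
  have hdet : LinearMap.det (S : RSpace d →ₗ[ℝ] RSpace d) =
      LinearMap.det (U : RSpace d →ₗ[ℝ] RSpace d) := by
    rw [hSA, hUA, adjoint_pow, det_adjoint]
  set C : ℝ := |LinearMap.det A| ^ (((j : ℤ) : ℝ) / 2) with hC
  have hC2 : C ^ 2 = |LinearMap.det A| ^ j := by
    rw [hC, ← Real.rpow_natCast, ← Real.rpow_mul (abs_nonneg _), ← Real.rpow_natCast]
    congr 1
    push_cast
    ring
  have hinner : inner ℂ (affineElement hA ψ j k) ((𝓕⁻ (hbc.toSchwartzMap hb)).toLp 2) =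
      (C : ℂ) * ∫ x, starRingEnd ℂ (ψ (U x - latticePoint k)) * 𝓕⁻ b x := by
    rw [L2.inner_def, ← integral_const_mul]
    refine integral_congr_ae ?_
    have h7 := (memLp_affine ψ (hA.equiv ^ (j : ℤ)) (latticePoint k)
      ((|LinearMap.det A| ^ (((j : ℤ) : ℝ) / 2) : ℝ) : ℂ)).coeFn_toLp
    filter_upwards [(𝓕⁻ (hbc.toSchwartzMap hb)).coeFn_toLp 2, h7] with x hx hx'
    rw [hx, affineElement, hx', RCLike.inner_apply, zpow_natCast, SchwartzMap.fourierInv_coe,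
      map_mul, Complex.conj_ofReal, mul_comm, mul_assoc]
    rfl
  rw [hinner, integral_conj_affine_mul_fourierInv hbc hb U S hUS hdet, norm_mul, mul_pow,
    Complex.norm_real, Real.norm_eq_abs, sq_abs, hC2]
  rfl

/-! ### Bessel's inequality and conclusion. -/

/-- The Fourier transforms of the generators of an orthonormal affine system are approximately
continuous at the origin, with value `0`. -/
theorem isApproxContinuousAtOrigin_of_orthonormal {d N : ℕ} {A : RSpace d →ₗ[ℝ] RSpace d}
    (hA : IsExpansiveDilation A) {Ψ : Fin N → L2 d} (hΨ : Orthonormal ℂ (affineSystem hA Ψ))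
    (α : Fin N) {g : RSpace d → ℂ}
    (hg : g =ᵐ[volume] ((𝓕 (Ψ α) : L2 d) : RSpace d → ℂ)) (hg0 : g 0 = 0) :
    IsApproxContinuousAtOrigin (LinearMap.adjoint A) g := by
  let β : ContDiffBump (0 : RSpace d) := ⟨1, 2, one_pos, one_lt_two⟩
  let b : RSpace d → ℂ := fun x => (β x : ℂ)
  have hbc : HasCompactSupport b := β.hasCompactSupport.comp_left (g := Complex.ofReal) rfl
  have hb : ContDiff ℝ (⊤ : ℕ∞) b := Complex.ofRealCLM.contDiff.comp β.contDiff
  set φ : RSpace d → ℂ := ((𝓕 (Ψ α) : L2 d) : RSpace d → ℂ) with hφ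
  have hφL : MemLp φ 2 volume := Lp.memLp _
  set T := LinearMap.adjoint A with hT
  have hTc : ∀ j : ℕ, Continuous (T ^ j : Module.End ℝ (RSpace d)) := fun j =>
    LinearMap.continuous_of_finiteDimensional _
  let F : ℕ → RSpace d → ℂ := fun j η =>
    b ((T ^ j : Module.End ℝ (RSpace d)) η) * starRingEnd ℂ (φ η)
  have hFL : ∀ j, MemLp (F j) 2 volume := by
    intro j
    refine MemLp.of_le hφL (((hb.continuous.comp (hTc j)).aestronglyMeasurable).mul
      (Complex.continuous_conj.comp_aestronglyMeasurable hφL.1)) (Eventually.of_forall fun η => ?_)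
    simp only [F, b, norm_mul, RCLike.norm_conj, Complex.norm_real, Real.norm_eq_abs,
      abs_of_nonneg β.nonneg]
    exact mul_le_of_le_one_left (norm_nonneg _) β.le_one
  set q := |LinearMap.det A| with hq
  have hq0 : 0 < q := abs_pos.2 hA.det_ne_zero
  set V := volume (Metric.ball (0 : RSpace d) 1) with hV
  have hV0 : V ≠ 0 := (Metric.measure_ball_pos volume _ one_pos).ne'
  have hVt : V ≠ ∞ := measure_ball_lt_top.ne
  have hVr : 0 < V.toReal := ENNReal.toReal_pos hV0 hVt
  -- From scale $J$ on, $T^{-j}B_2\subseteq B_{1/2}$, inside the cube of Parseval's identity.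
  obtain ⟨J, hJ⟩ := eventually_atTop.1 (hA.eventually_norm_lt 2 (ε := 1 / 2) (by norm_num))
  have hsupp : ∀ j, J ≤ j → ∀ x, F j x ≠ 0 → ∀ i, |x i| < 1 / 2 := by
    intro j hj x hx i
    refine lt_of_le_of_lt (PiLp.norm_apply_le x i) (hJ j hj x ?_)
    by_contra h
    refine hx ?_
    have : β ((T ^ j : Module.End ℝ (RSpace d)) x) = 0 :=
      β.zero_of_le_dist (by simpa using not_lt.1 h)
    simp [F, b, this]
  have hbessel := hΨ.inner_products_summable ((𝓕⁻ (hbc.toSchwartzMap hb)).toLp 2)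
  have hinj : Function.Injective fun i : ℕ × (Fin d → ℤ) =>
      ((α, ((i.1 + J : ℕ) : ℤ), i.2) : Fin N × ℤ × (Fin d → ℤ)) := by
    rintro ⟨i, k⟩ ⟨i', k'⟩ h
    simp only [Prod.mk.injEq, true_and] at h
    ext1
    · have := h.1; simp only; omega
    · exact h.2
  have hs : Summable fun j : ℕ => q ^ (j + J) * ∫ x, ‖F (j + J) x‖ ^ 2 := by
    have h1 := (hbessel.comp_injective hinj).prod
    refine h1.congr fun j => ?_
    have h2 := (hasSum_sq_norm_integral_cube (hFL (j + J))
      (hsupp _ (Nat.le_add_left J j))).mul_left (q ^ (j + J))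
    rw [← h2.tsum_eq]
    refine tsum_congr fun k => ?_
    exact norm_sq_inner_affineElement hA hbc hb (Ψ α) (j + J) k
  -- The finitely many scales below $J$ are restored; dividing by $|B_1|$ gives bounds for the
  -- averages.
  have hs' : Summable fun j : ℕ => q ^ j * (∫ x, ‖F j x‖ ^ 2) / V.toReal :=
    ((summable_nat_add_iff (f := fun j : ℕ => q ^ j * ∫ x, ‖F j x‖ ^ 2) J).1 hs).div_const _
  refine isApproxContinuousAtOrigin_of_summable hA (Lp.stronglyMeasurable _).measurable hs'
    (fun j => div_nonneg (mul_nonneg (by positivity) (integral_nonneg fun _ => by positivity))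
      ENNReal.toReal_nonneg) (fun j => ?_) hg hg0
  have hrhs : ENNReal.ofReal |(LinearMap.det A)⁻¹| ^ j * V *
      ENNReal.ofReal (q ^ j * (∫ x, ‖F j x‖ ^ 2) / V.toReal) =
      ENNReal.ofReal (∫ x, ‖F j x‖ ^ 2) := by
    rw [← ENNReal.ofReal_pow (abs_nonneg _), ← ENNReal.ofReal_toReal hVt,
      ← ENNReal.ofReal_mul (by positivity), ← ENNReal.ofReal_mul (by positivity),
      ENNReal.toReal_ofReal hVr.le, abs_inv, ← hq, inv_pow]
    congr 1
    field_simp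
  rw [hrhs, ofReal_integral_eq_lintegral_ofReal ((memLp_two_iff_integrable_sq_norm (hFL j).1).1
    (hFL j)) (Eventually.of_forall fun _ => by positivity)]
  -- The bump is $1$ on $B_1$, so $|F_j|=|\varphi|$ on $T^{-j}B_1$.
  refine le_trans (lintegral_mono_ae ?_) (setLIntegral_le_lintegral
    ((T ^ j : Module.End ℝ (RSpace d)) ⁻¹' Metric.ball 0 1) _)
  refine (ae_restrict_iff' ((hTc j).measurable measurableSet_ball)).2
    (Eventually.of_forall fun x hx => ?_)
  have hβ : β ((T ^ j : Module.End ℝ (RSpace d)) x) = 1 :=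
    β.one_of_mem_closedBall (Metric.ball_subset_closedBall hx)
  have hn : ‖F j x‖ = ‖φ x‖ := by simp [F, b, hβ]
  rw [hn, ENNReal.ofReal_pow (norm_nonneg _), ofReal_norm]

end Multiwavelet

theorem mainTheorem6 {d N : ℕ}
    (A : Multiwavelet.RSpace d →ₗ[ℝ] Multiwavelet.RSpace d)
    (hA : Multiwavelet.IsExpansiveDilation A)
    (G : Set (Multiwavelet.RSpace d)) (hG : MeasurableSet G)
    (hGA : LinearMap.adjoint A '' G = G)
    (Ψ : Fin N → Multiwavelet.L2 d)
    (hΨ : Multiwavelet.IsOrthogonalMultiwavelet hA G Ψ)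
    (α : Fin N) (g : Multiwavelet.RSpace d → ℂ)
    (hg : g =ᵐ[volume] ((𝓕 (Ψ α) : Multiwavelet.L2 d) : Multiwavelet.RSpace d → ℂ))
    (hg0 : g 0 = 0) :
    Multiwavelet.IsApproxContinuousAtOrigin (LinearMap.adjoint A) g :=
  Multiwavelet.isApproxContinuousAtOrigin_of_orthonormal hA hΨ.1 α hg hg0
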